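/- Let $R$ be a finite commutative local principal ring of odd characteristic, whose maximal ideal is $\mathfrak m=Rx$, and let $\ell\ge 1$ be the nilpotency degree of $\mathfrak m$. Let $A=R[y]=R\oplus Ry$, where $y^2=x$, be the corresponding ramified quadratic extension, with involution $(r+sy)^*=r-sy$. Let $V$ be a non-zero free $A$-module of finite rank $m$ and let $h:V\times V\to A$ be a non-degenerate $*$-hermitian form, that is, $h$ is $A$-linear in the second variable, $h(v,u)=h(u,v)^*$, and $v\mapsto h(v,-)$ is a bijection of $V$ onto $\mathrm{Hom}_A(V,A)$. Let $U=U_m(A)$ be the unitary group of all $A$-linear automorphisms of $V$ that preserve $h$, and let $H$ be the Heisenberg group of all pairs $(a,v)\in A\times V$ with $(a,v)(b,w)=(a+b+h(v,w),\,v+w)$, on which $U$ acts by ${}^g(a,v)=(a,gv)$. Let $\lambda:R^+\to\mathbb C^\times$ be a linear character whose kernel contains no non-zero ideal of $R$, and put $\mu(r+sy)=\lambda(2s)$. Set $V_0=y^\ell V$ and let $Z=\mathbb C\zeta$ be the one-dimensional module of $(A,V_0)\rtimes U$ given by $(a,u)g\,\zeta=\mu(a)\zeta$. The Weil module $X$ of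 $U$ is the restriction to $U$ of the induced module $\mathrm{ind}_{(A,V_0)\rtimes U}^{H\rtimes U}Z$. More generally, a Weil representation of $U$ of type $\mu$ is a representation $W:U\to\mathrm{GL}(Y)$ on a complex vector space $Y$ for which there is an irreducible representation $S:H\to\mathrm{GL}(Y)$ such that $(a,0)$ acts as the scalar $\mu(a)$ for all $a\in A$, such that $S$ is equivalent to its conjugates under all additive automorphisms of $V$ that preserve $h$, and such that $W(g)S(k)W(g)^{-1}=S({}^gk)$ for all $g\in U$, $k\in H$. Then the Weil module $X$ of $U$ is multiplicity free, i.e. every irreducible constituent of $X$ occurs in $X$ with multiplicity one. The same holds for every Weil representation of $U$ of type $\mu$. -/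

import Mathlib

/-! ### Heisenberg groups, Schrödinger representations, multiplicities -/

/-- The Heisenberg group `H(f)` of a bi-additive map `f : V × V → R`: pairs `(r, v)` with
`(r, v)(s, w) = (r + s + f(v, w), v + w)`. -/
@[ext]
structure Heis {R V : Type*} [AddCommGroup R] [AddCommGroup V] (f : V →+ V →+ R) where
  /-- the central coordinate `r` of `(r, v)` -/
  cen : R
  /-- the vector coordinate `v` of `(r, v)` -/
  vec : V

namespace Heis

variable {R V : Type*} [AddCommGroup R] [AddCommGroup V] {f : V →+ V →+ R}

instance : Mul (Heis f) := ⟨fun a b => ⟨a.cen + b.cen + f a.vec b.vec, a.vec + b.vec⟩⟩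

instance : One (Heis f) := ⟨⟨0, 0⟩⟩

instance : Inv (Heis f) := ⟨fun a => ⟨-a.cen + f a.vec a.vec, -a.vec⟩⟩

@[simp] theorem mul_cen (a b : Heis f) : (a * b).cen = a.cen + b.cen + f a.vec b.vec := rfl

@[simp] theorem mul_vec (a b : Heis f) : (a * b).vec = a.vec + b.vec := rfl

@[simp] theorem one_cen : (1 : Heis f).cen = 0 := rfl

@[simp] theorem one_vec : (1 : Heis f).vec = 0 := rfl

@[simp] theorem inv_cen (a : Heis f) : (a⁻¹).cen = -a.cen + f a.vec a.vec := rfl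

@[simp] theorem inv_vec (a : Heis f) : (a⁻¹).vec = -a.vec := rfl

instance : Group (Heis f) :=
  Group.ofLeftAxioms
    (fun a b c => by
      ext
      · simp only [mul_cen, mul_vec, map_add, AddMonoidHom.add_apply]; abel
      · simp only [mul_vec]; abel)
    (fun a => by ext <;> simp)
    (fun a => by ext <;> simp)

/-- An additive automorphism `g` of `V` preserving `f` acts on `H(f)` by `(r, v) ↦ (r, g v)`. -/
def isometryAct (g : V ≃+ V) (hg : ∀ u v, f (g u) (g v) = f u v) : Heis f ≃* Heis f where
  toFun a := ⟨a.cen, g a.vec⟩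
  invFun a := ⟨a.cen, g.symm a.vec⟩
  left_inv a := by ext <;> simp
  right_inv a := by ext <;> simp
  map_mul' a b := by ext <;> simp [hg]

@[simp] theorem isometryAct_apply (g : V ≃+ V) (hg : ∀ u v, f (g u) (g v) = f u v)
    (a : Heis f) : isometryAct g hg a = ⟨a.cen, g a.vec⟩ := rfl

end Heis

/-- `S` is a Schrödinger representation of `H(f)` of type `lam`: it is irreducible, the central
subgroup `(R, 0)` acts through `lam`, and `S` is equivalent to its conjugate by every element of
the isometry group `G(f)` (all additive automorphisms of `V` that preserve `f`). -/
structure IsSchrodinger {R V X : Type*} [AddCommGroup R] [AddCommGroup V]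
    [AddCommGroup X] [Module ℂ X] {f : V →+ V →+ R} (lam : AddChar R ℂ)
    (S : Representation ℂ (Heis f) X) : Prop where
  irreducible : S.IsIrreducible
  central : ∀ (r : R) (w : X), S ⟨r, 0⟩ w = lam r • w
  invariant : ∀ (g : V ≃+ V) (hg : ∀ u v, f (g u) (g v) = f u v),
    Nonempty (S.Equiv (S.comp (Heis.isometryAct g hg).toMonoidHom))

/-- A representation is multiplicity free if every irreducible constituent `τ` of it occurs in it
with multiplicity `dim Hom_G(τ, ρ) = 1`. (For the finite groups below every irreducible
constituent is a subrepresentation.) -/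
def IsMultiplicityFree {G X : Type*} [Group G] [AddCommGroup X] [Module ℂ X]
    (ρ : Representation ℂ G X) : Prop :=
  ∀ τ : Subrepresentation ρ, τ.toRepresentation.IsIrreducible →
    Module.finrank ℂ (Representation.IntertwiningMap τ.toRepresentation ρ) = 1

/-! ### The ramified quadratic extension and its hermitian forms -/

/-- `A = R[y] = R ⊕ R y` with `y² = x`. Its `star` is the involution `(r + s y)* = r - s y`. -/
abbrev RamExt (R : Type*) (x : R) [Zero R] : Type _ := QuadraticAlgebra R x 0

/-- The element `y` of `A`. -/
abbrev RamExt.y {R : Type*} [CommRing R] (x : R) : RamExt R x := QuadraticAlgebra.omega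

/-- The additive map `d : A → R`, `d (r + s y) = 2 s`. -/
def RamExt.d {R : Type*} [CommRing R] (x : R) : RamExt R x →+ R where
  toFun a := 2 * a.im
  map_zero' := by simp
  map_add' a b := by simp [mul_add]

/-- The character `μ = λ ∘ d` of `A⁺`. -/
def RamExt.mu {R : Type*} [CommRing R] (x : R) (lam : AddChar R ℂ) : AddChar (RamExt R x) ℂ :=
  lam.compAddMonoidHom (RamExt.d x)

/-- The nilpotency degree `ℓ` of the maximal ideal of `R`. -/
noncomputable def nilDegree (R : Type*) [CommRing R] [IsLocalRing R] : ℕ :=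
  nilpotencyClass (IsLocalRing.maximalIdeal R)

/-- The ideal `𝔦 = 𝔯 ^ ℓ` of `A`, where `𝔯 = A y`. -/
noncomputable def RamExt.iIdeal {R : Type*} [CommRing R] [IsLocalRing R] (x : R) :
    Ideal (RamExt R x) :=
  Ideal.span {RamExt.y x} ^ nilDegree R

/-- Maps `V × V → A` that are `A`-linear in the second and `*`-semilinear in the first variable. -/
abbrev SesqForm (R : Type*) [CommRing R] (x : R) (V : Type*) [AddCommGroup V]
    [Module (RamExt R x) V] : Type _ :=
  V →ₛₗ[starRingEnd (RamExt R x)] V →ₗ[RamExt R x] RamExt R x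

section Unitary

variable {R : Type*} [CommRing R] {x : R} {V : Type*} [AddCommGroup V] [Module (RamExt R x) V]

/-- `h` is a non-degenerate `*`-hermitian form: `h(v,u) = h(u,v)*`, and `v ↦ h(v,-)` is a
bijection of `V` onto its dual. -/
structure SesqForm.IsNondegHermitian (h : SesqForm R x V) : Prop where
  hermitian : ∀ u v, h v u = star (h u v)
  nondegenerate : Function.Bijective (fun v => (h v : Module.Dual (RamExt R x) V))

/-- `h` as a bi-additive map. -/
def SesqForm.biadd (h : SesqForm R x V) : V →+ V →+ RamExt R x :=
  AddMonoidHom.mk' (fun u => (h u).toAddMonoidHom) (fun u v => by ext w <;> simp)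

@[simp] theorem SesqForm.biadd_apply (h : SesqForm R x V) (u v : V) : h.biadd u v = h u v := rfl

/-- The unitary group `U = U_m(A)` of `h`: all `A`-linear automorphisms preserving `h`. -/
def SesqForm.unitary (h : SesqForm R x V) : Subgroup (V ≃ₗ[RamExt R x] V) where
  carrier := {g | ∀ u v, h (g u) (g v) = h u v}
  one_mem' := fun _ _ => rfl
  mul_mem' := fun {a b} ha hb u v => (ha (b u) (b v)).trans (hb u v)
  inv_mem' := fun {a} ha u v => by
    have := ha (a⁻¹ u) (a⁻¹ v)
    rwa [← LinearEquiv.mul_apply, ← LinearEquiv.mul_apply, mul_inv_cancel,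
      LinearEquiv.coe_one, id, id, eq_comm] at this

/-- The action of `U` on the Heisenberg group `H = H(h)`: `g (a, v) = (a, g v)`. -/
def SesqForm.act (h : SesqForm R x V) : h.unitary →* MulAut (Heis h.biadd) where
  toFun g := Heis.isometryAct g.1.toAddEquiv g.2
  map_one' := rfl
  map_mul' _ _ := rfl

/-- `W` is a Weil representation of `U` of type `mu`: there is a Schrödinger representation `S`
of `H(h)` of type `mu` on the same space with `W(g) S(k) W(g)⁻¹ = S(g k)`. -/
def SesqForm.IsWeil (h : SesqForm R x V) (mu : AddChar (RamExt R x) ℂ)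
    {X : Type*} [AddCommGroup X] [Module ℂ X] (W : Representation ℂ h.unitary X) : Prop :=
  ∃ S : Representation ℂ (Heis h.biadd) X, IsSchrodinger mu S ∧
    ∀ (g : h.unitary) (k : Heis h.biadd), W g * S k * W g⁻¹ = S (h.act g k)

end Unitary

/-! ### The Weil module -/

section WeilModule

variable {R : Type*} [CommRing R] [IsLocalRing R] {x : R}
  {V : Type*} [AddCommGroup V] [Module (RamExt R x) V]

/-- The submodule `V₀ = 𝔦 V`. -/
noncomputable def V0 (R : Type*) [CommRing R] [IsLocalRing R] (x : R)
    (V : Type*) [AddCommGroup V] [Module (RamExt R x) V] : Submodule (RamExt R x) V :=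
  RamExt.iIdeal x • ⊤

theorem map_mem_V0 (g : V ≃ₗ[RamExt R x] V) {u : V} (hu : u ∈ V0 R x V) : g u ∈ V0 R x V := by
  have := Submodule.mem_map_of_mem (f := g.toLinearMap) hu
  rw [V0, Submodule.map_smul''] at this
  exact Submodule.smul_mono le_rfl le_top this

theorem y_pow_two_nilDegree [Finite R] (hx : IsLocalRing.maximalIdeal R = Ideal.span {x}) :
    RamExt.y x ^ nilDegree R * RamExt.y x ^ nilDegree R = 0 := by
  have hn : IsNilpotent (IsLocalRing.maximalIdeal R) := by
    have := IsArtinianRing.isNilpotent_jacobson_bot (R := R)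
    rwa [IsLocalRing.jacobson_eq_maximalIdeal ⊥ bot_ne_top] at this
  have h1 : IsLocalRing.maximalIdeal R ^ nilDegree R = ⊥ := pow_nilpotencyClass hn
  rw [hx, Ideal.span_singleton_pow, Ideal.span_singleton_eq_bot] at h1
  have h2 : RamExt.y x * RamExt.y x = algebraMap R (RamExt R x) x := by
    ext <;> simp
  rw [← mul_pow, h2, ← map_pow, h1, map_zero]

theorem form_V0_V0 [Finite R] (hx : IsLocalRing.maximalIdeal R = Ideal.span {x})
    (h : SesqForm R x V) {u v : V} (hu : u ∈ V0 R x V) (hv : v ∈ V0 R x V) : h u v = 0 := by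
  rw [V0, RamExt.iIdeal, Ideal.span_singleton_pow, Submodule.ideal_span_singleton_smul] at hu hv
  obtain ⟨u', -, rfl⟩ := hu
  obtain ⟨v', -, rfl⟩ := hv
  have hs : star (RamExt.y x) = -RamExt.y x := by ext <;> simp
  have := y_pow_two_nilDegree hx
  simp only [DistribSMul.toLinearMap_apply, map_smulₛₗ, LinearMap.smul_apply, smul_eq_mul,
    starRingEnd_apply, star_pow, hs, RingHom.id_apply]
  rw [neg_pow]
  linear_combination ((-1) ^ nilDegree R * h u' v') * this

/-- The subgroup `(A, V₀) ⋊ U` of `H ⋊ U`. -/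
noncomputable def SesqForm.inducingSubgroup (h : SesqForm R x V) :
    Subgroup (Heis h.biadd ⋊[h.act] h.unitary) where
  carrier := {k | k.left.vec ∈ V0 R x V}
  one_mem' := (V0 R x V).zero_mem
  mul_mem' := fun {a _} ha hb =>
    (V0 R x V).add_mem ha (map_mem_V0 a.right.1 hb)
  inv_mem' := fun {a} ha =>
    map_mem_V0 (a.right⁻¹).1 ((V0 R x V).neg_mem ha)

/-- The one-dimensional module `Z = ℂ ζ` of `(A, V₀) ⋊ U`: `(a, u) g ζ = μ(a) ζ`. -/
noncomputable def SesqForm.inducingRep [Finite R]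
    (hx : IsLocalRing.maximalIdeal R = Ideal.span {x}) (h : SesqForm R x V)
    (lam : AddChar R ℂ) : Representation ℂ h.inducingSubgroup ℂ where
  toFun k := RamExt.mu x lam k.1.left.cen • (1 : Module.End ℂ ℂ)
  map_one' := by
    change RamExt.mu x lam 0 • (1 : Module.End ℂ ℂ) = 1
    simp
  map_mul' a b := by
    have h0 : h a.1.left.vec (a.1.right.1 b.1.left.vec) = 0 :=
      form_V0_V0 hx h a.2 (map_mem_V0 a.1.right.1 b.2)
    change RamExt.mu x lam (a.1.left.cen + b.1.left.cen +
      h a.1.left.vec (a.1.right.1 b.1.left.vec)) • (1 : Module.End ℂ ℂ) = _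
    rw [h0, add_zero, AddChar.map_add_eq_mul, smul_mul_smul_comm, one_mul]

/-- The Weil module `X` of `U`: the restriction to `U` of the `H ⋊ U`-module induced from the
`(A, V₀) ⋊ U`-module `Z`. -/
noncomputable def SesqForm.weilModule [Finite R]
    (hx : IsLocalRing.maximalIdeal R = Ideal.span {x}) (h : SesqForm R x V)
    (lam : AddChar R ℂ) :
    Representation ℂ h.unitary
      (Representation.IndV h.inducingSubgroup.subtype (h.inducingRep hx lam)) :=
  (Representation.ind h.inducingSubgroup.subtype (h.inducingRep hx lam)).comp SemidirectProduct.inr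

end WeilModule

/-! ### Averaging, Burnside's theorem and multiplicity freeness -/

section Averaging

variable {G X : Type*} [Group G] [AddCommGroup X] [Module ℂ X]

/-! The proof is a form of Gelfand's trick. A representation of a finite group is multiplicity free
once the operators commuting with it commute with each other (`isMultiplicityFree_of_commute`).
Since `S` is irreducible, Burnside's theorem writes every operator as `∑ c(v) S(0,v)`, and for an
operator commuting with `U` averaging makes `c` constant on `U`-orbits. Products of operators become
convolutions of coefficient functions twisted by `μ(h(u,v))`. An additive map `σ` with `h(σu,σv) =
h(v,u)` reverses the order of such a convolution. If `σ` also preserves every `U`-orbit, it fixes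
all invariant functions, so convolution is commutative on them (`commute_of_antiIsometry`).

Such a `σ` conjugates the coordinates in an orthogonal basis, which exists because 2 is a unit. It
is the identity modulo `y`. Every nonzero vector is `y^k w` with `w ∉ yV`, and `σ(y^k w) = ±y^k
σ(w)`, so with `-1 ∈ U` only such `w` matter. They are moved to `σ(w)` by hermitian reflections
(`exists_unitary_of_primitive`).

For the Weil module, irreducibility over `H` remains to be shown. The submodule `V₀` is its own
annihilator under the commutator pairing `μ(2h(u,v))`, so summing over `V₀` maps everything into
`ℂζ`, while the conjugates of this sum add up to a nonzero scalar. Hence every nonzero submodule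
contains the generator `ζ` (`isIrreducible_of_fixed`). -/

/-- The sum of all conjugates `ρ(g) T ρ(g)⁻¹` of a linear operator `T`. -/
noncomputable def sumConj [Fintype G] (ρ : Representation ℂ G X) (T : Module.End ℂ X) :
    Module.End ℂ X :=
  ∑ g : G, ρ g * T * ρ g⁻¹

theorem commute_sumConj [Fintype G] (ρ : Representation ℂ G X) (T : Module.End ℂ X) (k : G) :
    sumConj ρ T * ρ k = ρ k * sumConj ρ T := by
  rw [sumConj, Finset.sum_mul, Finset.mul_sum,
    ← Equiv.sum_comp (Equiv.mulLeft k) (fun g => ρ g * T * ρ g⁻¹ * ρ k)]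
  refine Finset.sum_congr rfl fun g _ => ?_
  simp only [Equiv.coe_mulLeft, mul_assoc, ← map_mul, mul_inv_rev, inv_mul_cancel, mul_one]
  rw [← mul_assoc (ρ k), ← map_mul]

theorem sumConj_of_commute [Fintype G] (ρ : Representation ℂ G X) (T : Module.End ℂ X)
    (hT : ∀ g, T * ρ g = ρ g * T) : sumConj ρ T = (Fintype.card G : ℂ) • T := by
  rw [sumConj, Finset.sum_congr rfl (g := fun _ => T), Finset.sum_const, Finset.card_univ,
    Nat.cast_smul_eq_nsmul]
  intro g _
  rw [← hT, mul_assoc, ← map_mul, mul_inv_cancel, map_one, mul_one]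

/-- An irreducible representation of a finite group is finite-dimensional. -/
theorem Representation.IsIrreducible.finiteDimensional_of_finite [Finite G]
    {ρ : Representation ℂ G X} (hρ : ρ.IsIrreducible) : FiniteDimensional ℂ X := by
  have : Nontrivial X := by
    by_contra hX
    rw [not_nontrivial_iff_subsingleton] at hX
    obtain ⟨τ, τ', hne⟩ := hρ.toNontrivial
    exact hne (SetLike.ext fun w => by
      rw [Subsingleton.elim w 0]
      exact iff_of_true τ.toSubmodule.zero_mem τ'.toSubmodule.zero_mem)
  obtain ⟨w, hw⟩ := exists_ne (0 : X)
  let τ : Subrepresentation ρ :=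
    { toSubmodule := Submodule.span ℂ (Set.range fun g => ρ g w)
      apply_mem_toSubmodule := fun g v hv => by
        refine Submodule.span_induction (p := fun v _ => ρ g v ∈ _) ?_ ?_ ?_ ?_ hv
        · rintro _ ⟨k, rfl⟩
          exact Submodule.subset_span ⟨g * k, by simp⟩
        · simp
        · intro a b _ _ ha hb
          rw [map_add]
          exact Submodule.add_mem _ ha hb
        · intro c a _ ha
          rw [map_smul]
          exact Submodule.smul_mem _ c ha }
  have hwτ : w ∈ τ.toSubmodule := Submodule.subset_span ⟨1, by simp⟩
  rcases hρ.eq_bot_or_eq_top τ with h | h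
  · rw [h] at hwτ
    exact absurd ((Submodule.mem_bot ℂ).1 hwτ) hw
  · have h' : Submodule.span ℂ (Set.range fun g => ρ g w) = ⊤ := by
      change τ.toSubmodule = ⊤
      rw [h]
      rfl
    exact Module.finite_def.2 (h' ▸ Submodule.fg_span (Set.finite_range _))

/-- Schur's lemma for operators. -/
theorem Representation.IsIrreducible.exists_eq_smul_one [FiniteDimensional ℂ X]
    {ρ : Representation ℂ G X} (hρ : ρ.IsIrreducible) (T : Module.End ℂ X)
    (hT : ∀ g, T * ρ g = ρ g * T) : ∃ c : ℂ, T = c • 1 := by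
  have := hρ
  obtain ⟨c, hc⟩ :=
    (Representation.IsIrreducible.algebraMap_intertwiningMap_bijective_of_isAlgClosed
      (ρ := ρ)).2 ⟨T, hT⟩
  refine ⟨c, ?_⟩
  have := congrArg (fun f => f.toLinearMap) hc
  exact this.symm

/-- Burnside's theorem: the operators of an irreducible representation of a finite group span the
space of all linear operators. -/
theorem Representation.IsIrreducible.span_range_eq_top [Finite G]
    {ρ : Representation ℂ G X} (hρ : ρ.IsIrreducible) :
    Submodule.span ℂ (Set.range ρ) = ⊤ := by
  have := Fintype.ofFinite G
  have hfin : FiniteDimensional ℂ X := hρ.finiteDimensional_of_finite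
  -- Rank-one operators suffice. By Schur the average of `f.smulRight u` is a scalar, determined by
  -- its trace; evaluating it at `z` and letting `u` vary expresses `f.smulRight z` through the `ρ
  -- g`.
  have hrank : ∀ (f : Module.Dual ℂ X) (z : X),
      f.smulRight z ∈ Submodule.span ℂ (Set.range ρ) := by
    intro f z
    rcases subsingleton_or_nontrivial X with hX | hX
    · rw [Subsingleton.elim (f.smulRight z) 0]
      exact Submodule.zero_mem _
    have hd : (Module.finrank ℂ X : ℂ) ≠ 0 := Nat.cast_ne_zero.2 Module.finrank_pos.ne'
    have hG : (Fintype.card G : ℂ) ≠ 0 := Nat.cast_ne_zero.2 Fintype.card_ne_zero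
    have key : ∀ u, (Module.finrank ℂ X : ℂ) • (∑ g : G, f (ρ g⁻¹ z) • ρ g) u =
        (Fintype.card G : ℂ) • (f.smulRight z) u := by
      intro u
      obtain ⟨c, hc⟩ := hρ.exists_eq_smul_one (sumConj ρ (f.smulRight u)) (commute_sumConj ρ _)
      have htr : c * Module.finrank ℂ X = Fintype.card G * f u := by
        have := congrArg (LinearMap.trace ℂ X) hc
        rw [sumConj, map_sum, map_smul, LinearMap.trace_one, smul_eq_mul] at this
        rw [← this, Finset.sum_congr rfl (g := fun _ => f u), Finset.sum_const, Finset.card_univ,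
          nsmul_eq_mul]
        intro g _
        rw [LinearMap.trace_mul_comm, ← mul_assoc, ← map_mul, inv_mul_cancel, map_one, one_mul,
          LinearMap.trace_smulRight]
      have hz := LinearMap.congr_fun hc z
      simp only [sumConj, LinearMap.sum_apply, Module.End.mul_apply, LinearMap.smulRight_apply,
        map_smul, LinearMap.smul_apply, Module.End.one_apply] at hz
      rw [LinearMap.sum_apply]
      simp only [LinearMap.smul_apply]
      rw [hz, smul_smul, LinearMap.smulRight_apply, smul_smul, ← htr, mul_comm]
    have key' : f.smulRight z =
        ((Fintype.card G : ℂ)⁻¹ * Module.finrank ℂ X) • ∑ g : G, f (ρ g⁻¹ z) • ρ g := by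
      ext u
      rw [LinearMap.smul_apply, mul_smul, key, inv_smul_smul₀ hG]
    rw [key']
    exact Submodule.smul_mem _ _ (Submodule.sum_mem _ fun g _ =>
      Submodule.smul_mem _ _ (Submodule.subset_span ⟨g, rfl⟩))
  rw [eq_top_iff]
  intro T _
  let b := Module.finBasis ℂ X
  have hT : T = ∑ i, (b.coord i).smulRight (T (b i)) := by
    refine b.ext fun j => ?_
    simp [LinearMap.sum_apply, Finsupp.single_apply]
  rw [hT]
  exact Submodule.sum_mem _ fun i _ => hrank _ _

/-- A representation of a finite group with commutative endomorphism algebra is multiplicity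
free. -/
theorem isMultiplicityFree_of_commute [Finite G] [FiniteDimensional ℂ X]
    (ρ : Representation ℂ G X)
    (hcomm : ∀ S T : Module.End ℂ X, (∀ g, S * ρ g = ρ g * S) → (∀ g, T * ρ g = ρ g * T) →
      S * T = T * S) : IsMultiplicityFree ρ := by
  intro τ hτ
  have := Fintype.ofFinite G
  have hG : (Fintype.card G : ℂ) ≠ 0 := Nat.cast_ne_zero.2 Fintype.card_ne_zero
  obtain ⟨p₀, hp₀⟩ := LinearMap.exists_leftInverse_of_injective τ.toSubmodule.subtype
    τ.toSubmodule.ker_subtype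
  have hp₀' : ∀ w : τ.toSubmodule, p₀ w = w := fun w => LinearMap.congr_fun hp₀ w
  -- Maschke: averaging a linear projection gives an equivariant projection onto `τ`.
  set P : Module.End ℂ X :=
    (Fintype.card G : ℂ)⁻¹ • sumConj ρ (τ.toSubmodule.subtype ∘ₗ p₀) with hP
  have hPcomm : ∀ g, P * ρ g = ρ g * P := fun g => by
    rw [hP, smul_mul_assoc, commute_sumConj, mul_smul_comm]
  have hPmem : ∀ w, P w ∈ τ.toSubmodule := fun w => by
    rw [hP, LinearMap.smul_apply, sumConj, LinearMap.sum_apply]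
    exact Submodule.smul_mem _ _ (Submodule.sum_mem _ fun g _ =>
      τ.apply_mem_toSubmodule g (p₀ _).2)
  have hPid : ∀ w ∈ τ.toSubmodule, P w = w := fun w hw => by
    rw [hP, LinearMap.smul_apply, sumConj, LinearMap.sum_apply,
      Finset.sum_congr rfl (g := fun _ => w), Finset.sum_const, Finset.card_univ,
      ← Nat.cast_smul_eq_nsmul ℂ, inv_smul_smul₀ hG]
    intro g _
    have := hp₀' ⟨ρ g⁻¹ w, τ.apply_mem_toSubmodule g⁻¹ hw⟩
    simp only [Module.End.mul_apply, LinearMap.comp_apply, this, Submodule.subtype_apply]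
    rw [← Module.End.mul_apply, ← map_mul, mul_inv_cancel, map_one, Module.End.one_apply]
  let Q : X →ₗ[ℂ] τ.toSubmodule := P.codRestrict _ hPmem
  have hQ : ∀ w : τ.toSubmodule, Q w = w := fun w => Subtype.ext (hPid w w.2)
  let ι : Representation.IntertwiningMap τ.toRepresentation ρ :=
    ⟨τ.toSubmodule.subtype, fun g => rfl⟩
  have hcommQ : ∀ (φ : Representation.IntertwiningMap τ.toRepresentation ρ) (g : G),
      (φ.toLinearMap ∘ₗ Q) * ρ g = ρ g * (φ.toLinearMap ∘ₗ Q) := by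
    intro φ g
    ext w
    have h1 : Q (ρ g w) = τ.toRepresentation g (Q w) :=
      Subtype.ext (LinearMap.congr_fun (hPcomm g) w)
    simp only [Module.End.mul_apply, LinearMap.comp_apply, h1]
    exact Representation.IntertwiningMap.isIntertwining _ _ φ g (Q w)
  have hne : ι ≠ 0 := by
    intro h0
    obtain ⟨σ, σ', hne⟩ := hτ.toNontrivial
    refine hne (SetLike.ext fun w => ?_)
    have : w = 0 := Subtype.ext (congrArg (fun f => f w) h0)
    rw [this]
    exact iff_of_true σ.toSubmodule.zero_mem σ'.toSubmodule.zero_mem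
  refine finrank_eq_one ι hne fun φ => ?_
  obtain ⟨c, hc⟩ := hτ.exists_eq_smul_one (Q ∘ₗ φ.toLinearMap) (fun g => by
    ext1 w
    have h1 : ∀ u, Q (ρ g u) = τ.toRepresentation g (Q u) := fun u =>
      Subtype.ext (LinearMap.congr_fun (hPcomm g) u)
    have h2 : φ.toLinearMap (τ.toRepresentation g w) = ρ g (φ.toLinearMap w) :=
      Representation.IntertwiningMap.isIntertwining _ _ φ g w
    simp only [Module.End.mul_apply, LinearMap.comp_apply, h1, h2])
  refine ⟨c, Representation.IntertwiningMap.ext (LinearMap.ext fun w => ?_)⟩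
  -- Commuting `φ ∘ Q` with the projection `ι ∘ Q` forces `φ` to take values in `τ`, where Schur
  -- makes it a scalar.
  have h3 := LinearMap.congr_fun
    (hcomm (φ.toLinearMap ∘ₗ Q) (ι.toLinearMap ∘ₗ Q) (hcommQ φ) (hcommQ ι)) w
  simp only [Module.End.mul_apply, LinearMap.comp_apply] at h3
  rw [hQ w] at h3
  have h4 : Q (ι.toLinearMap w) = w := hQ w
  rw [h4] at h3
  have h5 : Q (φ.toLinearMap w) = c • w := LinearMap.congr_fun hc w
  rw [h3, h5]
  rfl

end Averaging

/-! ### Commutativity of the endomorphism algebra of a Weil representation -/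

section Commutant

variable {R : Type*} [CommRing R] {x : R} {V : Type*} [AddCommGroup V] [Module (RamExt R x) V]
  {X : Type*} [AddCommGroup X] [Module ℂ X]

theorem Heis.apply_eq_smul {h : SesqForm R x V} {mu : AddChar (RamExt R x) ℂ}
    {S : Representation ℂ (Heis h.biadd) X} (hS : ∀ a w, S ⟨a, 0⟩ w = mu a • w)
    (a : RamExt R x) (v : V) : S ⟨a, v⟩ = mu a • S ⟨0, v⟩ := by
  have h1 : (⟨a, v⟩ : Heis h.biadd) = ⟨a, 0⟩ * ⟨0, v⟩ := by ext <;> simp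
  ext w
  rw [h1, map_mul, Module.End.mul_apply, hS, LinearMap.smul_apply]

theorem Heis.apply_mul_apply {h : SesqForm R x V} {mu : AddChar (RamExt R x) ℂ}
    {S : Representation ℂ (Heis h.biadd) X} (hS : ∀ a w, S ⟨a, 0⟩ w = mu a • w)
    (u v : V) : S ⟨0, u⟩ * S ⟨0, v⟩ = mu (h u v) • S ⟨0, u + v⟩ := by
  rw [← map_mul, ← Heis.apply_eq_smul hS]
  congr 1
  ext <;> simp

/-- The twisted convolution of two functions on `V`. -/
noncomputable def twistedConv [Fintype V] (h : SesqForm R x V) (mu : AddChar (RamExt R x) ℂ)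
    (c d : V → ℂ) (w : V) : ℂ :=
  ∑ u, c u * d (w - u) * mu (h u (w - u))

theorem twistedConv_isometry [Fintype V] (h : SesqForm R x V) (mu : AddChar (RamExt R x) ℂ)
    {c d : V → ℂ} {g : h.unitary} (hc : ∀ v, c (g.1 v) = c v) (hd : ∀ v, d (g.1 v) = d v) (w : V) :
    twistedConv h mu c d (g.1 w) = twistedConv h mu c d w := by
  rw [twistedConv, ← Equiv.sum_comp g.1.toEquiv]
  refine Finset.sum_congr rfl fun u _ => ?_
  have : h (g.1 u) (g.1 (w - u)) = h u (w - u) := g.2 _ _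
  simp only [LinearEquiv.coe_toEquiv, ← map_sub, hc, hd, this]

/-- Substituting `σ u` for `u` swaps the arguments of `h`; then `u ↦ w - u` restores them while
exchanging the roles of `c` and `d`. -/
theorem twistedConv_antiIsometry [Fintype V] (h : SesqForm R x V) (mu : AddChar (RamExt R x) ℂ)
    {c d : V → ℂ} (σ : V →+ V) (hσ : ∀ u v, h (σ u) (σ v) = h v u) (hbij : Function.Bijective σ)
    (hc : ∀ v, c (σ v) = c v) (hd : ∀ v, d (σ v) = d v) (w : V) :
    twistedConv h mu c d (σ w) = twistedConv h mu d c w := by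
  rw [twistedConv, twistedConv, ← Equiv.sum_comp (Equiv.ofBijective σ hbij),
    ← Equiv.sum_comp (Equiv.subLeft w)]
  refine Finset.sum_congr rfl fun u _ => ?_
  simp only [Equiv.ofBijective_apply, Equiv.subLeft_apply, ← map_sub, hc, hd, hσ]
  rw [sub_sub_cancel, mul_comm (c _)]

theorem sum_smul_mul_sum_smul [Fintype V] {h : SesqForm R x V} {mu : AddChar (RamExt R x) ℂ}
    {S : Representation ℂ (Heis h.biadd) X} (hS : ∀ a w, S ⟨a, 0⟩ w = mu a • w) (c d : V → ℂ) :
    (∑ u, c u • S ⟨0, u⟩) * (∑ v, d v • S ⟨0, v⟩) = ∑ w, twistedConv h mu c d w • S ⟨0, w⟩ := by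
  simp only [twistedConv, Finset.sum_smul]
  rw [Finset.sum_comm, Finset.sum_mul]
  refine Finset.sum_congr rfl fun u _ => ?_
  rw [Finset.mul_sum, ← Equiv.sum_comp (Equiv.addLeft u)
    (fun w => (c u * d (w - u) * mu (h u (w - u))) • S ⟨0, w⟩)]
  refine Finset.sum_congr rfl fun v _ => ?_
  simp only [Equiv.coe_addLeft, add_sub_cancel_left]
  rw [smul_mul_smul_comm, Heis.apply_mul_apply hS, smul_smul]

theorem exists_eq_sum_smul [Fintype V] {h : SesqForm R x V} {mu : AddChar (RamExt R x) ℂ}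
    {S : Representation ℂ (Heis h.biadd) X} (hS : ∀ a w, S ⟨a, 0⟩ w = mu a • w)
    (hspan : Submodule.span ℂ (Set.range S) = ⊤) (T : Module.End ℂ X) :
    ∃ c : V → ℂ, T = ∑ v, c v • S ⟨0, v⟩ := by
  have hle : Submodule.span ℂ (Set.range S) ≤
      Submodule.span ℂ (Set.range fun v : V => S ⟨0, v⟩) := by
    rw [Submodule.span_le]
    rintro _ ⟨⟨a, v⟩, rfl⟩
    rw [Heis.apply_eq_smul hS]
    exact Submodule.smul_mem _ _ (Submodule.subset_span ⟨v, rfl⟩)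
  have hT : T ∈ Submodule.span ℂ (Set.range fun v : V => S ⟨0, v⟩) :=
    hle (hspan ▸ Submodule.mem_top)
  obtain ⟨c, hc⟩ := (Submodule.mem_span_range_iff_exists_fun ℂ).1 hT
  exact ⟨c, hc.symm⟩

/-- Averaging any choice of coefficients over `U` avoids having to know that the `S(0,v)` are
linearly independent. -/
theorem exists_invariant_eq_sum_smul [Fintype V] {h : SesqForm R x V} [Fintype h.unitary]
    {mu : AddChar (RamExt R x) ℂ}
    {S : Representation ℂ (Heis h.biadd) X} (hS : ∀ a w, S ⟨a, 0⟩ w = mu a • w)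
    (hspan : Submodule.span ℂ (Set.range S) = ⊤) (W : Representation ℂ h.unitary X)
    (hW : ∀ (g : h.unitary) (k : Heis h.biadd), W g * S k * W g⁻¹ = S (h.act g k))
    (T : Module.End ℂ X) (hT : ∀ g, T * W g = W g * T) :
    ∃ c : V → ℂ, (∀ (g : h.unitary) v, c (g.1 v) = c v) ∧ T = ∑ v, c v • S ⟨0, v⟩ := by
  obtain ⟨c, hc⟩ := exists_eq_sum_smul hS hspan T
  have hU : (Fintype.card h.unitary : ℂ) ≠ 0 := Nat.cast_ne_zero.2 Fintype.card_ne_zero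
  refine ⟨fun v => (Fintype.card h.unitary : ℂ)⁻¹ * ∑ k : h.unitary, c (k.1 v),
    fun g v => ?_, ?_⟩
  · dsimp only
    rw [← Equiv.sum_comp (Equiv.mulRight g) (fun k : h.unitary => c (k.1 v))]
    rfl
  · have h1 : T = (Fintype.card h.unitary : ℂ)⁻¹ • sumConj W T := by
      rw [sumConj_of_commute W T hT, inv_smul_smul₀ hU]
    have h2 : sumConj W T = ∑ v, (∑ k : h.unitary, c (k.1 v)) • S ⟨0, v⟩ := by
      simp only [Finset.sum_smul]
      rw [Finset.sum_comm, sumConj, ← Equiv.sum_comp (Equiv.inv h.unitary)]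
      refine Finset.sum_congr rfl fun g _ => ?_
      rw [hc, Finset.mul_sum, Finset.sum_mul, ← Equiv.sum_comp g.1.toEquiv]
      refine Finset.sum_congr rfl fun v _ => ?_
      rw [mul_smul_comm, smul_mul_assoc, Equiv.inv_apply, hW]
      congr 2
      have : (g⁻¹).1 (g.1 v) = v := by
        rw [← LinearEquiv.mul_apply, ← Subgroup.coe_mul, inv_mul_cancel]
        rfl
      exact Heis.ext rfl this
    conv_lhs => rw [h1, h2, Finset.smul_sum]
    simp only [smul_smul]

/-- The operators commuting with a Weil representation commute with each other, if `V` has an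
anti-isometry that preserves each orbit of the unitary group. -/
theorem commute_of_antiIsometry [Finite V] {h : SesqForm R x V} {mu : AddChar (RamExt R x) ℂ}
    {S : Representation ℂ (Heis h.biadd) X} (hS : ∀ a w, S ⟨a, 0⟩ w = mu a • w)
    (hspan : Submodule.span ℂ (Set.range S) = ⊤) (W : Representation ℂ h.unitary X)
    (hW : ∀ (g : h.unitary) (k : Heis h.biadd), W g * S k * W g⁻¹ = S (h.act g k))
    (σ : V →+ V) (hσ : ∀ u v, h (σ u) (σ v) = h v u)
    (horb : ∀ v, ∃ g : h.unitary, g.1 v = σ v)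
    (T T' : Module.End ℂ X) (hT : ∀ g, T * W g = W g * T) (hT' : ∀ g, T' * W g = W g * T') :
    T * T' = T' * T := by
  have := Fintype.ofFinite V
  have : Finite (V ≃ₗ[RamExt R x] V) := DFunLike.finite _
  have := Fintype.ofFinite h.unitary
  have hbij : Function.Bijective σ := by
    refine Finite.injective_iff_bijective.1 ((injective_iff_map_eq_zero σ).2 fun v hv => ?_)
    obtain ⟨g, hg⟩ := horb v
    rwa [hv, LinearEquiv.map_eq_zero_iff] at hg
  obtain ⟨c, hc, rfl⟩ := exists_invariant_eq_sum_smul hS hspan W hW T hT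
  obtain ⟨d, hd, rfl⟩ := exists_invariant_eq_sum_smul hS hspan W hW T' hT'
  have hcσ : ∀ v, c (σ v) = c v := fun v => by
    obtain ⟨g, hg⟩ := horb v
    rw [← hg, hc]
  have hdσ : ∀ v, d (σ v) = d v := fun v => by
    obtain ⟨g, hg⟩ := horb v
    rw [← hg, hd]
  rw [sum_smul_mul_sum_smul hS, sum_smul_mul_sum_smul hS]
  -- Coefficientwise, `(c*d)(w) = (c*d)(g w) = (c*d)(σ w) = (d*c)(w)`.
  refine Finset.sum_congr rfl fun w _ => ?_
  obtain ⟨g, hg⟩ := horb w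
  rw [← twistedConv_antiIsometry h mu σ hσ hbij hcσ hdσ, ← hg,
    twistedConv_isometry h mu (hc g) (hd g)]

end Commutant

/-! ### Units and valuations in the ramified quadratic extension -/

section Ring

theorem isUnit_two_of_odd_ringChar {R : Type*} [CommRing R] (hodd : Odd (ringChar R)) :
    IsUnit (2 : R) := by
  obtain ⟨k, hk⟩ := hodd
  have h1 : ((2 * k + 1 : ℕ) : R) = 0 := by rw [← hk, ringChar.Nat.cast_ringChar]
  push_cast at h1
  exact IsUnit.of_mul_eq_one (-(k : R)) (by linear_combination -h1)

theorem RamExt.star_y {R : Type*} [CommRing R] {x : R} : star (RamExt.y x) = -RamExt.y x := by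
  ext <;> simp

variable {R : Type*} [CommRing R] [IsLocalRing R] {x : R}

/-- Reduction of `A = R[y]` modulo its maximal ideal `A y`. -/
noncomputable def RamExt.residue (hx : IsLocalRing.maximalIdeal R = Ideal.span {x}) :
    RamExt R x →+* IsLocalRing.ResidueField R :=
  have h0 : IsLocalRing.residue R x = 0 :=
    (IsLocalRing.residue_eq_zero_iff x).2 (hx ▸ Ideal.mem_span_singleton_self x)
  { toFun := fun a => IsLocalRing.residue R a.re
    map_one' := map_one (IsLocalRing.residue R)
    map_zero' := by simp
    map_add' := by simp
    map_mul' := by simp [h0] }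

variable (hx : IsLocalRing.maximalIdeal R = Ideal.span {x})

theorem RamExt.residue_apply (a : RamExt R x) :
    RamExt.residue hx a = IsLocalRing.residue R a.re := rfl

@[simp] theorem RamExt.residue_star (a : RamExt R x) :
    RamExt.residue hx (star a) = RamExt.residue hx a := by
  simp [RamExt.residue_apply]

/-- The involution is trivial on the residue field, so the norm `a a*` reduces to the square of the
residue of `a`. -/
theorem RamExt.isUnit_iff_residue_ne_zero {a : RamExt R x} :
    IsUnit a ↔ RamExt.residue hx a ≠ 0 := by
  refine ⟨fun ha => (ha.map (RamExt.residue hx)).ne_zero, fun ha => ?_⟩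
  rw [QuadraticAlgebra.isUnit_iff_norm_isUnit, ← IsLocalRing.residue_ne_zero_iff_isUnit]
  have h1 : algebraMap R (RamExt R x) a.norm = a * star a :=
    QuadraticAlgebra.algebraMap_norm_eq_mul_star a
  have h2 : IsLocalRing.residue R a.norm = RamExt.residue hx (a * star a) := by
    rw [← h1]
    rfl
  rw [h2, map_mul, RamExt.residue_star]
  exact mul_ne_zero ha ha

theorem RamExt.exists_eq_y_mul {a : RamExt R x} (ha : RamExt.residue hx a = 0) :
    ∃ b, a = RamExt.y x * b := by
  rw [RamExt.residue_apply, IsLocalRing.residue_eq_zero_iff, hx,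
    Ideal.mem_span_singleton] at ha
  obtain ⟨r, hr⟩ := ha
  exact ⟨⟨a.im, r⟩, by ext <;> simp [hr]⟩

/-- The last power of `y` that survives is `y^(2ℓ-1) = x^(ℓ-1) y`, by minimality of `ℓ`. -/
theorem RamExt.y_pow_eq_zero_iff
    (hx : IsLocalRing.maximalIdeal R = Ideal.span {x}) [Finite R] (n : ℕ) :
    RamExt.y x ^ n = 0 ↔ 2 * nilDegree R ≤ n := by
  have hyy : RamExt.y x * RamExt.y x = algebraMap R (RamExt R x) x := by
    ext <;> simp
  constructor
  · intro hn
    by_contra! hlt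
    have h1 : RamExt.y x ^ (2 * (nilDegree R - 1) + 1) = 0 :=
      pow_eq_zero_of_le (by omega) hn
    rw [pow_succ, pow_mul, pow_two, hyy, ← map_pow] at h1
    have h2 : x ^ (nilDegree R - 1) = 0 := by
      have := congrArg QuadraticAlgebra.im h1
      rw [QuadraticAlgebra.im_mul] at this
      simpa only [QuadraticAlgebra.algebraMap_re, QuadraticAlgebra.algebraMap_im,
        QuadraticAlgebra.omega_im, QuadraticAlgebra.omega_re, QuadraticAlgebra.im_zero,
        mul_one, mul_zero, zero_mul, add_zero] using this
    have h3 : IsLocalRing.maximalIdeal R ^ (nilDegree R - 1) = 0 := by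
      rw [hx, Ideal.span_singleton_pow, h2]
      simp
    have h4 : nilDegree R ≤ nilDegree R - 1 := Nat.sInf_le h3
    omega
  · intro hn
    refine pow_eq_zero_of_le hn ?_
    rw [two_mul, pow_add]
    exact y_pow_two_nilDegree hx

end Ring

/-! ### Isometries and an anti-isometry of a hermitian space -/

section Hermitian

variable {R : Type*} [CommRing R] {x : R}
  {V : Type*} [AddCommGroup V] [Module (RamExt R x) V] {h : SesqForm R x V}

theorem SesqForm.IsNondegHermitian.eq_zero (hh : h.IsNondegHermitian) {v : V}
    (hv : ∀ w, h v w = 0) : v = 0 :=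
  hh.nondegenerate.1 (a₂ := 0) (LinearMap.ext fun w => by simp [hv])

theorem SesqForm.IsNondegHermitian.star_self (hh : h.IsNondegHermitian) (v : V) :
    star (h v v) = h v v := (hh.hermitian v v).symm

/-- A linear endomorphism preserving a non-degenerate form on a finite module is a unitary
automorphism. -/
theorem SesqForm.IsNondegHermitian.exists_unitary_of_isometry [Finite V]
    (hh : h.IsNondegHermitian) (f : V →ₗ[RamExt R x] V) (hf : ∀ u v, h (f u) (f v) = h u v) :
    ∃ g : h.unitary, ∀ v, g.1 v = f v := by
  have hinj : Function.Injective f := by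
    refine (injective_iff_map_eq_zero f).2 fun v hv => hh.eq_zero fun w => ?_
    rw [← hf, hv, map_zero, LinearMap.zero_apply]
  exact ⟨⟨LinearEquiv.ofBijective f (Finite.injective_iff_bijective.1 hinj), hf⟩, fun _ => rfl⟩

/-- Two vectors `v`, `w` of the same length are conjugate under the unitary group if
`h(v - w, v)` is a unit. -/
theorem SesqForm.IsNondegHermitian.exists_unitary_apply_eq [Finite V]
    (hh : h.IsNondegHermitian) {v w : V} (hvw : h v v = h w w) (hu : IsUnit (h (v - w) v)) :
    ∃ g : h.unitary, g.1 v = w := by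
  obtain ⟨c, hc⟩ := hu.exists_left_inv
  set δ := v - w with hδ
  have hc' : star c * star (h δ v) = 1 := by rw [← star_mul', hc, star_one]
  have hsum : h δ v + star (h δ v) = h δ δ := by
    rw [← hh.hermitian]
    simp only [hδ, map_sub, LinearMap.sub_apply, ← hvw]
    ring
  -- A hermitian reflection along `δ`. With `c = h(δ,v)⁻¹` it sends `v` to `v - δ = w`, and `hsum`
  -- is the condition `c + c* = c c* h(δ,δ)` for it to be an isometry.
  obtain ⟨g, hg⟩ := hh.exists_unitary_of_isometry (LinearMap.id - (c • h δ).smulRight δ) (by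
    intro z z'
    simp only [LinearMap.sub_apply, LinearMap.id_apply, LinearMap.smulRight_apply,
      LinearMap.smul_apply, smul_eq_mul, map_sub, map_smulₛₗ, RingHom.id_apply,
      starRingEnd_apply, star_mul', ← hh.hermitian]
    linear_combination (h z δ * h δ z') *
      (c * star c * (-hsum) + star c * hc + c * hc'))
  refine ⟨g, ?_⟩
  rw [hg]
  simp only [LinearMap.sub_apply, LinearMap.id_apply, LinearMap.smulRight_apply,
      LinearMap.smul_apply, smul_eq_mul, hc, one_smul]
  rw [hδ, sub_sub_cancel]

/-- Orthogonal families of vectors of unit length. -/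
def SesqForm.IsOrthogonalFamily (h : SesqForm R x V) (s : Finset V) : Prop :=
  (∀ w ∈ s, IsUnit (h w w)) ∧ ∀ w ∈ s, ∀ z ∈ s, w ≠ z → h w z = 0

/-- The projection onto the span of an orthogonal family. -/
noncomputable def SesqForm.orthProj (h : SesqForm R x V) (s : Finset V) :
    V →ₗ[RamExt R x] V :=
  ∑ w ∈ s, (Ring.inverse (h w w) • h w).smulRight w

theorem SesqForm.orthProj_apply (s : Finset V) (v : V) :
    h.orthProj s v = ∑ w ∈ s, (Ring.inverse (h w w) * h w v) • w := by
  simp [SesqForm.orthProj, LinearMap.sum_apply]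

theorem SesqForm.IsOrthogonalFamily.apply_orthProj {s : Finset V} (hs : h.IsOrthogonalFamily s)
    {w : V} (hw : w ∈ s) (v : V) : h w (h.orthProj s v) = h w v := by
  rw [SesqForm.orthProj_apply, map_sum, Finset.sum_eq_single w]
  · rw [map_smul, smul_eq_mul, mul_right_comm, Ring.inverse_mul_cancel _ (hs.1 w hw), one_mul]
  · intro w' hw' hne
    rw [map_smul, hs.2 w hw w' hw' hne.symm, smul_zero]
  · exact fun hn => absurd hw hn

theorem SesqForm.neg_apply_mem (g : h.unitary) : ∃ g' : h.unitary, ∀ v, g'.1 v = -g.1 v :=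
  ⟨⟨g.1.trans (LinearEquiv.neg (RamExt R x)), fun u v => by
    simpa using g.2 u v⟩, fun _ => rfl⟩

variable [IsLocalRing R] (hx : IsLocalRing.maximalIdeal R = Ideal.span {x})

/-- Divisibility of `v` by powers of `y` stops because `y` is nilpotent. The resulting `w` lies
outside `yV`. -/
theorem exists_eq_y_pow_smul
    (hx : IsLocalRing.maximalIdeal R = Ideal.span {x}) [Finite R] {v : V} (hv : v ≠ 0) :
    ∃ (k : ℕ) (w : V), v = RamExt.y x ^ k • w ∧ ∀ z, v ≠ RamExt.y x ^ (k + 1) • z := by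
  classical
  have hex : ∃ n, ∀ z : V, v ≠ RamExt.y x ^ n • z := by
    refine ⟨2 * nilDegree R, fun z hz => hv ?_⟩
    rw [hz, (RamExt.y_pow_eq_zero_iff hx _).2 le_rfl, zero_smul]
  have h0 : Nat.find hex ≠ 0 := fun h0 =>
    Nat.find_spec hex v (by rw [h0, pow_zero, one_smul])
  obtain ⟨k, hk⟩ := Nat.exists_eq_succ_of_ne_zero h0
  have h1 := Nat.find_min hex (m := k) (by omega)
  push Not at h1
  obtain ⟨w, hw⟩ := h1
  refine ⟨k, w, hw, ?_⟩
  have := Nat.find_spec hex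
  rwa [hk] at this

/-- A vector outside `y V` pairs to `1` with some vector. -/
theorem SesqForm.IsNondegHermitian.exists_apply_eq_one
    (hx : IsLocalRing.maximalIdeal R = Ideal.span {x}) [Module.Free (RamExt R x) V]
    [Module.Finite (RamExt R x) V] (hh : h.IsNondegHermitian) {v : V}
    (hv : ∀ z, v ≠ RamExt.y x • z) : ∃ u, h u v = 1 := by
  let b := Module.Free.chooseBasis (RamExt R x) V
  have h1 : ∃ i, RamExt.residue hx (b.repr v i) ≠ 0 := by
    by_contra! h0
    choose c hc using fun i => RamExt.exists_eq_y_mul hx (h0 i)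
    refine hv (∑ i, c i • b i) ?_
    rw [← b.sum_repr v, Finset.smul_sum]
    exact Finset.sum_congr rfl fun i _ => by rw [hc i, mul_smul]
  obtain ⟨i, hi⟩ := h1
  obtain ⟨c, hc⟩ := ((RamExt.isUnit_iff_residue_ne_zero hx).2 hi).exists_left_inv
  -- The functional reading off a unit coordinate of `v`, suitably scaled, is represented by some
  -- `u`.
  obtain ⟨u, hu⟩ := hh.nondegenerate.2 (c • b.coord i)
  refine ⟨u, ?_⟩
  change (fun v => (h v : Module.Dual (RamExt R x) V)) u v = 1
  rw [hu, LinearMap.smul_apply, smul_eq_mul, b.coord_apply, hc]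

/-- If all three lengths were non-units, `h(u+v,u+v) ≡ h(u,u) + 2 + h(v,v)` would give `2 ≡ 0`. -/
theorem SesqForm.IsNondegHermitian.exists_isUnit
    (hx : IsLocalRing.maximalIdeal R = Ideal.span {x}) (hh : h.IsNondegHermitian)
    (h2 : IsUnit (2 : R)) {u v : V} (huv : h u v = 1) (hv : ¬ IsUnit (h v v)) :
    IsUnit (h u u) ∨ IsUnit (h (u + v) (u + v)) := by
  by_contra! hcon
  simp only [RamExt.isUnit_iff_residue_ne_zero hx, not_not] at hv hcon
  have hvu : h v u = 1 := by rw [hh.hermitian, huv, star_one]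
  have h1 := hcon.2
  simp only [map_add, LinearMap.add_apply, hv, hcon.1, huv, hvu, map_one] at h1
  apply (h2.map (IsLocalRing.residue R)).ne_zero
  rw [map_ofNat]
  linear_combination h1

/-- A non-degenerate hermitian space has an orthogonal family of vectors that spans it. -/
theorem SesqForm.IsNondegHermitian.exists_isOrthogonalFamily
    (hx : IsLocalRing.maximalIdeal R = Ideal.span {x}) [Finite R] [Finite V]
    [Module.Free (RamExt R x) V] [Module.Finite (RamExt R x) V]
    (hh : h.IsNondegHermitian) (h2 : IsUnit (2 : R)) :
    ∃ s : Finset V, h.IsOrthogonalFamily s ∧ ∀ v, h.orthProj s v = v := by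
  classical
  obtain ⟨s, hs, hmax⟩ := Set.Finite.exists_maximal (s := {s | h.IsOrthogonalFamily s})
    (Set.toFinite _) ⟨∅, by simp [SesqForm.IsOrthogonalFamily]⟩
  refine ⟨s, hs, ?_⟩
  by_contra! hne
  obtain ⟨v₀, hv₀⟩ := hne
  let p : V →ₗ[RamExt R x] V := LinearMap.id - h.orthProj s
  have hp : ∀ w ∈ s, ∀ v, h w (p v) = 0 := fun w hw v => by
    simp [p, hs.apply_orthProj hw]
  have hperp : ∀ v, (∀ w ∈ s, h w v = 0) → p v = v := fun v hv => by
    simp only [p, LinearMap.sub_apply, LinearMap.id_apply, SesqForm.orthProj_apply]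
    rw [Finset.sum_eq_zero fun w hw => by rw [hv w hw, mul_zero, zero_smul], sub_zero]
  have hv₁ : p v₀ ≠ 0 := fun h0 => hv₀ (sub_eq_zero.1 h0).symm
  -- If `s` does not span, dividing by a power of `y` gives a vector `p v'` of the orthogonal
  -- complement outside `yV`. Its unit pairing with some `p u` yields a complement vector of unit
  -- length, contradicting maximality of `s`.
  obtain ⟨k, v', hv', hk⟩ := exists_eq_y_pow_smul hx hv₁
  have hv'' : p v₀ = RamExt.y x ^ k • p v' := by
    rw [← map_smul, ← hv', hperp (p v₀) fun w hw => hp w hw _]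
  obtain ⟨u, hu⟩ := hh.exists_apply_eq_one hx (v := p v') fun z hz => hk z (by
    rw [hv'', hz, smul_smul, pow_succ])
  have hu' : h (p u) (p v') = 1 := by
    have hpu : p u = u - h.orthProj s u := rfl
    rw [hpu, map_sub, LinearMap.sub_apply, hu, sub_eq_self, SesqForm.orthProj_apply, map_sum,
      LinearMap.sum_apply]
    refine Finset.sum_eq_zero fun w hw => ?_
    rw [map_smulₛₗ, LinearMap.smul_apply, hp w hw, smul_zero]
  have hex : ∃ t, IsUnit (h t t) ∧ ∀ w ∈ s, h w t = 0 := by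
    by_cases hv : IsUnit (h (p v') (p v'))
    · exact ⟨_, hv, fun w hw => hp w hw _⟩
    · rcases hh.exists_isUnit hx h2 hu' hv with h1 | h1
      · exact ⟨_, h1, fun w hw => hp w hw _⟩
      · exact ⟨_, h1, fun w hw => by rw [map_add, hp w hw, hp w hw, add_zero]⟩
  obtain ⟨t, ht, hts⟩ := hex
  have hnot : t ∉ s := fun hmem => ht.ne_zero (hts t hmem)
  have hins : h.IsOrthogonalFamily (insert t s) := by
    refine ⟨?_, ?_⟩
    · intro w hw
      rcases Finset.mem_insert.1 hw with rfl | hw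
      exacts [ht, hs.1 w hw]
    · intro w hw w' hw' hne
      rcases Finset.mem_insert.1 hw with rfl | hw₁ <;>
        rcases Finset.mem_insert.1 hw' with rfl | hw₁'
      · exact absurd rfl hne
      · rw [hh.hermitian, hts w' hw₁', star_zero]
      · exact hts w hw₁
      · exact hs.2 w hw₁ w' hw₁' hne
  exact hnot (hmax hins (Finset.subset_insert t s) (Finset.mem_insert_self t s))

/-- A non-degenerate hermitian space has a `*`-semilinear anti-isometry that is the identity
modulo the maximal ideal. -/
theorem SesqForm.IsNondegHermitian.exists_antiIsometry [Finite R] [Finite V]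
    [Module.Free (RamExt R x) V] [Module.Finite (RamExt R x) V]
    (hh : h.IsNondegHermitian) (h2 : IsUnit (2 : R)) :
    ∃ σ : V →+ V, (∀ (a : RamExt R x) v, σ (a • v) = star a • σ v) ∧
      (∀ u v, h (σ u) (σ v) = h v u) ∧
      ∀ u v, RamExt.residue hx (h u (σ v)) = RamExt.residue hx (h u v) := by
  obtain ⟨s, hs, hspan⟩ := hh.exists_isOrthogonalFamily hx h2
  have hexp : ∀ u v, h u v = ∑ w ∈ s, Ring.inverse (h w w) * h w v * h u w := fun u v => by
    conv_lhs => rw [← hspan v, SesqForm.orthProj_apply, map_sum]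
    simp only [map_smul, smul_eq_mul]
  have hstar : ∀ w ∈ s, star (Ring.inverse (h w w)) = Ring.inverse (h w w) := fun w hw => by
    have h1 := Ring.inverse_mul_cancel _ (hs.1 w hw)
    have h3 := congrArg star h1
    rw [star_mul', hh.star_self, star_one] at h3
    linear_combination Ring.inverse (h w w) * h3 - star (Ring.inverse (h w w)) * h1
  -- Conjugation of the coordinates with respect to the orthogonal family.
  let σ : V →+ V := AddMonoidHom.mk'
    (fun v => ∑ w ∈ s, (Ring.inverse (h w w) * star (h w v)) • w) fun u v => by
      rw [← Finset.sum_add_distrib]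
      exact Finset.sum_congr rfl fun w _ => by rw [map_add, star_add, mul_add, add_smul]
  have hσ : ∀ v, σ v = ∑ w ∈ s, (Ring.inverse (h w w) * star (h w v)) • w := fun _ => rfl
  have hwσ : ∀ w ∈ s, ∀ v, h w (σ v) = star (h w v) := fun w hw v => by
    rw [hσ, map_sum, Finset.sum_eq_single w]
    · rw [map_smul, smul_eq_mul, mul_right_comm, Ring.inverse_mul_cancel _ (hs.1 w hw), one_mul]
    · intro w' hw' hne
      rw [map_smul, hs.2 w hw w' hw' hne.symm, smul_zero]
    · exact fun hn => absurd hw hn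
  refine ⟨σ, fun a v => ?_, fun u v => ?_, fun u v => ?_⟩
  · rw [hσ, hσ, Finset.smul_sum]
    refine Finset.sum_congr rfl fun w _ => ?_
    rw [map_smul, smul_eq_mul, star_mul', smul_smul]
    congr 1
    ring
  · rw [hexp v u, hσ u, map_sum, LinearMap.sum_apply]
    refine Finset.sum_congr rfl fun w hw => ?_
    rw [map_smulₛₗ, LinearMap.smul_apply, smul_eq_mul, hwσ w hw, starRingEnd_apply, star_mul',
      star_star, hstar w hw, ← hh.hermitian]
  · rw [hexp u v, hσ v, map_sum, map_sum, map_sum]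
    refine Finset.sum_congr rfl fun w _ => ?_
    rw [map_smul, smul_eq_mul, map_mul, map_mul, map_mul, map_mul, RamExt.residue_star]

/-- The vectors outside `y V` are moved within their orbits by the anti-isometry. -/
theorem SesqForm.IsNondegHermitian.exists_unitary_of_primitive [Finite V]
    [Module.Free (RamExt R x) V] [Module.Finite (RamExt R x) V]
    (hh : h.IsNondegHermitian) (h2 : IsUnit (2 : R)) (σ : V →+ V)
    (hσ : ∀ u v, h (σ u) (σ v) = h v u)
    (hres : ∀ u v, RamExt.residue hx (h u (σ v)) = RamExt.residue hx (h u v))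
    {v : V} (hv : ∀ z, v ≠ RamExt.y x • z) : ∃ g : h.unitary, g.1 v = σ v := by
  have h2' : (2 : IsLocalRing.ResidueField R) ≠ 0 := by
    have := (h2.map (IsLocalRing.residue R)).ne_zero
    rwa [map_ofNat] at this
  have hres' : ∀ u v, RamExt.residue hx (h (σ u) v) = RamExt.residue hx (h u v) := fun u v => by
    rw [hh.hermitian v, RamExt.residue_star, hres, hh.hermitian u, RamExt.residue_star]
  by_cases hvv : IsUnit (h v v)
  -- The reflection targets `-σ v`: since `σ v ≡ v`, the difference `v - σ v` never pairs to a unit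
  -- with `v`, whereas `v + σ v ≡ 2v` does.
  · have h1 : IsUnit (h (v - -σ v) v) := by
      rw [RamExt.isUnit_iff_residue_ne_zero hx] at hvv ⊢
      rw [sub_neg_eq_add, map_add, LinearMap.add_apply, map_add, hres', ← two_mul]
      exact mul_ne_zero h2' hvv
    obtain ⟨g, hg⟩ := hh.exists_unitary_apply_eq (w := -σ v) (by simp [hσ]) h1
    obtain ⟨g', hg'⟩ := SesqForm.neg_apply_mem g
    exact ⟨g', by rw [hg', hg, neg_neg]⟩
  · obtain ⟨u, hu⟩ := hh.exists_apply_eq_one hx hv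
    have hvv' : RamExt.residue hx (h v v) = 0 := by
      rwa [RamExt.isUnit_iff_residue_ne_zero hx, not_not] at hvv
    have hex : ∃ w, IsUnit (h w w) ∧ IsUnit (h w v) := by
      rcases hh.exists_isUnit hx h2 hu hvv with h1 | h1
      · exact ⟨u, h1, by rw [hu]; exact isUnit_one⟩
      · refine ⟨u + v, h1, ?_⟩
        rw [RamExt.isUnit_iff_residue_ne_zero hx, map_add, LinearMap.add_apply, map_add, hvv',
          hu, map_one, add_zero]
        exact one_ne_zero
    obtain ⟨w, hw, hwv⟩ := hex
    obtain ⟨c, hc⟩ := hw.exists_left_inv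
    have hc0 : RamExt.residue hx c ≠ 0 := fun h0 => by
      have := congrArg (RamExt.residue hx) hc
      rw [map_mul, h0, zero_mul, map_one] at this
      exact zero_ne_one this
    have hcs : star c = c := by
      have h3 := congrArg star hc
      rw [star_mul', hh.star_self, star_one] at h3
      linear_combination c * h3 - star c * hc
    rw [RamExt.isUnit_iff_residue_ne_zero hx] at hwv
    -- With this `a`, `v - a • w` is the mirror image of `v` in `w`, hence of the same length. Both
    -- `v` and `σ v` can be reflected onto it, since the pairings required to be units are `≡ ±2c
    -- h(w,v)²`.
    set a := 2 * c * h w v with ha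
    have hzv : ∀ v', h (v - a • w) v' = h v v' - star a * h w v' := fun v' => by
      rw [map_sub, LinearMap.sub_apply, map_smulₛₗ, LinearMap.smul_apply, starRingEnd_apply,
        smul_eq_mul]
    have hz : h v v = h (v - a • w) (v - a • w) := by
      rw [hzv, map_sub, map_sub, map_smul, map_smul, ha, star_mul', star_mul', star_ofNat, hcs,
        ← hh.hermitian, smul_eq_mul, smul_eq_mul]
      linear_combination (-4 * c * h w v * h v w) * hc
    have hares : RamExt.residue hx (star a * h w v) ≠ 0 := by
      rw [map_mul, RamExt.residue_star, ha, map_mul, map_mul, map_ofNat]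
      exact mul_ne_zero (mul_ne_zero (mul_ne_zero h2' hc0) hwv) hwv
    obtain ⟨g₁, hg₁⟩ := hh.exists_unitary_apply_eq (w := v - a • w) hz (by
      rw [RamExt.isUnit_iff_residue_ne_zero hx, map_sub, LinearMap.sub_apply, hzv,
        sub_sub_cancel]
      exact hares)
    obtain ⟨g₂, hg₂⟩ := hh.exists_unitary_apply_eq (v := σ v) (w := v - a • w)
      ((hσ v v).trans hz) (by
      rw [RamExt.isUnit_iff_residue_ne_zero hx, map_sub, LinearMap.sub_apply, hσ, map_sub, hres,
        hzv, map_sub, hvv', zero_sub, zero_sub, neg_neg]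
      exact hares)
    refine ⟨g₂⁻¹ * g₁, ?_⟩
    change g₂.1.symm (g₁.1 v) = σ v
    rw [hg₁, ← hg₂, LinearEquiv.symm_apply_apply]

/-- A non-degenerate hermitian space has an anti-isometry that preserves each orbit of the unitary
group. -/
theorem SesqForm.IsNondegHermitian.exists_antiIsometry_orbit
    (hx : IsLocalRing.maximalIdeal R = Ideal.span {x}) [Finite R] [Finite V]
    [Module.Free (RamExt R x) V] [Module.Finite (RamExt R x) V]
    (hh : h.IsNondegHermitian) (h2 : IsUnit (2 : R)) :
    ∃ σ : V →+ V, (∀ u v, h (σ u) (σ v) = h v u) ∧ ∀ v, ∃ g : h.unitary, g.1 v = σ v := by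
  obtain ⟨σ, hsemi, hσ, hres⟩ := hh.exists_antiIsometry hx h2
  refine ⟨σ, hσ, fun v => ?_⟩
  by_cases hv : v = 0
  · exact ⟨1, by simp [hv]⟩
  obtain ⟨k, w, rfl, hk⟩ := exists_eq_y_pow_smul hx hv
  obtain ⟨g, hg⟩ := hh.exists_unitary_of_primitive hx h2 σ hσ hres (v := w) fun z hz => hk z (by
    rw [hz, smul_smul, pow_succ])
  rw [hsemi, star_pow, RamExt.star_y]
  -- `σ(y^k w) = (-y)^k σ(w)`; for odd `k` the sign is absorbed by `-1 ∈ U`.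
  rcases Nat.even_or_odd k with hk' | hk'
  · exact ⟨g, by rw [hk'.neg_pow, map_smul, hg]⟩
  · obtain ⟨g', hg'⟩ := SesqForm.neg_apply_mem g
    exact ⟨g', by rw [hk'.neg_pow, map_smul, hg', hg, smul_neg, neg_smul]⟩

end Hermitian

/-! ### Irreducibility of the induced module over the Heisenberg group -/

/-! ### The commutator pairing and its character sums. -/

section Characters

variable {R : Type*} [CommRing R] {x : R} {lam : AddChar R ℂ}

/-- The elements `a = r y` and `a = r` test the two coordinates of `b` separately against `λ(2 ·)`,
which is primitive as 2 is a unit. -/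
theorem RamExt.eq_zero_of_forall_mu (h2 : IsUnit (2 : R)) (hlam : lam.IsPrimitive)
    {b : RamExt R x} (hb : ∀ a, RamExt.mu x lam (a * b) = 1) : b = 0 := by
  have hr : ∀ s : R, (∀ r : R, lam (2 * (r * s)) = 1) → s = 0 := by
    intro s hs
    by_contra hne
    refine hlam (a := 2 * s) (fun h0 => hne (h2.mul_right_eq_zero.1 h0)) ?_
    ext r
    rw [AddChar.mulShift_apply, AddChar.one_apply, ← hs r]
    congr 1
    ring
  have hmu : ∀ a : RamExt R x, RamExt.mu x lam a = lam (2 * a.im) := fun _ => rfl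
  ext
  · refine hr _ fun r => ?_
    have := hb ⟨0, r⟩
    rw [hmu] at this
    simpa using this
  · refine hr _ fun r => ?_
    have := hb ⟨r, 0⟩
    rw [hmu] at this
    simpa using this

variable {V : Type*} [AddCommGroup V] [Module (RamExt R x) V] {h : SesqForm R x V}

/-- The involution inverts `μ`, so the commutator of `(0,u)` and `(0,v)` acts through `μ(2h(u,v))`.
-/
theorem SesqForm.IsNondegHermitian.mu_sub (hh : h.IsNondegHermitian) (lam : AddChar R ℂ)
    (u v : V) : RamExt.mu x lam (h u v) =
      RamExt.mu x lam (2 * h u v) * RamExt.mu x lam (h v u) := by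
  rw [← AddChar.map_add_eq_mul, hh.hermitian u v, two_mul]
  have hmu : ∀ a : RamExt R x, RamExt.mu x lam a = lam (2 * a.im) := fun _ => rfl
  rw [hmu, hmu]
  congr 1
  simp

/-- The character `v ↦ μ(2 h(u, v))` of `V`. -/
noncomputable def SesqForm.commChar (h : SesqForm R x V) (lam : AddChar R ℂ) (u : V) :
    AddChar V ℂ :=
  (RamExt.mu x lam).compAddMonoidHom ((AddMonoidHom.mulLeft 2).comp (h u).toAddMonoidHom)

theorem SesqForm.commChar_apply (lam : AddChar R ℂ) (u v : V) :
    h.commChar lam u v = RamExt.mu x lam (2 * h u v) := rfl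

theorem SesqForm.IsNondegHermitian.commChar_swap (hh : h.IsNondegHermitian) (lam : AddChar R ℂ)
    (u v : V) : h.commChar lam u v = h.commChar lam v (-u) := by
  rw [SesqForm.commChar_apply, SesqForm.commChar_apply, hh.hermitian v u]
  have hmu : ∀ a : RamExt R x, RamExt.mu x lam a = lam (2 * a.im) := fun _ => rfl
  rw [hmu, hmu]
  congr 1
  simp [two_mul]

theorem isUnit_two_ramExt (h2 : IsUnit (2 : R)) : IsUnit (2 : RamExt R x) := by
  have := h2.map (algebraMap R (RamExt R x))
  rwa [map_ofNat] at this

/-- The character is nontrivial: evaluated on all multiples `a • v`, it detects `h(u,v)`. -/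
theorem SesqForm.IsNondegHermitian.sum_commChar [Fintype V] (hh : h.IsNondegHermitian)
    (h2 : IsUnit (2 : R)) (hlam : lam.IsPrimitive) {u : V} (hu : u ≠ 0) :
    ∑ v, h.commChar lam u v = 0 := by
  classical
  rw [AddChar.sum_eq_zero_iff_ne_zero]
  intro h0
  refine hu (hh.eq_zero fun v => ?_)
  refine (isUnit_two_ramExt h2).mul_right_eq_zero.1
    (RamExt.eq_zero_of_forall_mu h2 hlam fun a => ?_)
  have h1 := DFunLike.congr_fun h0 (a • v)
  rw [SesqForm.commChar_apply, map_smul, smul_eq_mul, AddChar.zero_apply] at h1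
  rw [← h1]
  congr 1
  ring

variable [IsLocalRing R] (hx : IsLocalRing.maximalIdeal R = Ideal.span {x})

theorem mem_V0_iff {v : V} : v ∈ V0 R x V ↔ ∃ w, v = RamExt.y x ^ nilDegree R • w := by
  rw [V0, RamExt.iIdeal, Ideal.span_singleton_pow, Submodule.ideal_span_singleton_smul]
  constructor
  · rintro ⟨w, -, rfl⟩
    exact ⟨w, rfl⟩
  · rintro ⟨w, rfl⟩
    exact ⟨w, trivial, rfl⟩

/-- Write `v = y^k w` with `w` pairing to 1 with some vector. Then `y^(ℓ+k) = 0`, so `k ≥ ℓ`. -/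
theorem SesqForm.IsNondegHermitian.mem_V0_of_smul_eq_zero
    (hx : IsLocalRing.maximalIdeal R = Ideal.span {x}) [Finite R]
    [Module.Free (RamExt R x) V] [Module.Finite (RamExt R x) V] (hh : h.IsNondegHermitian)
    {v : V} (hv : RamExt.y x ^ nilDegree R • v = 0) : v ∈ V0 R x V := by
  by_cases hv0 : v = 0
  · exact hv0 ▸ Submodule.zero_mem _
  obtain ⟨k, w, rfl, hk⟩ := exists_eq_y_pow_smul hx hv0
  obtain ⟨u, hu⟩ := hh.exists_apply_eq_one hx (v := w) fun z hz => hk z (by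
    rw [hz, smul_smul, pow_succ])
  have h1 := congrArg (h u) hv
  rw [smul_smul, ← pow_add, map_smul, hu, map_zero, smul_eq_mul, mul_one,
    RamExt.y_pow_eq_zero_iff hx] at h1
  obtain ⟨j, rfl⟩ : ∃ j, k = nilDegree R + j := ⟨k - nilDegree R, by omega⟩
  exact mem_V0_iff.2 ⟨RamExt.y x ^ j • w, by rw [smul_smul, pow_add]⟩

/-- If `v` pairs trivially with `y^ℓ V`, then `y^ℓ h(v,u) = 0` for all `u`, so `y^ℓ v = 0` and `v ∈
V₀`. Thus `V₀` contains its own annihilator. -/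
theorem SesqForm.IsNondegHermitian.sum_V0_commChar
    (hx : IsLocalRing.maximalIdeal R = Ideal.span {x}) [Finite R] [Fintype (V0 R x V)]
    [Module.Free (RamExt R x) V] [Module.Finite (RamExt R x) V] (hh : h.IsNondegHermitian)
    (h2 : IsUnit (2 : R)) (hlam : lam.IsPrimitive) {v : V} (hv : v ∉ V0 R x V) :
    ∑ u : V0 R x V, h.commChar lam v u = 0 := by
  classical
  change ∑ u : V0 R x V, (h.commChar lam v).compAddMonoidHom (V0 R x V).subtype.toAddMonoidHom u = 0
  rw [AddChar.sum_eq_zero_iff_ne_zero]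
  intro h0
  refine hv (hh.mem_V0_of_smul_eq_zero hx (hh.eq_zero fun u => ?_))
  have h1 : RamExt.y x ^ nilDegree R * h v u = 0 := by
    refine (isUnit_two_ramExt h2).mul_right_eq_zero.1
      (RamExt.eq_zero_of_forall_mu h2 hlam fun a => ?_)
    have h1 : h.commChar lam v (RamExt.y x ^ nilDegree R • a • u) = 1 :=
      DFunLike.congr_fun h0 ⟨_, mem_V0_iff.2 ⟨a • u, rfl⟩⟩
    rw [SesqForm.commChar_apply, map_smul, map_smul, smul_eq_mul, smul_eq_mul] at h1
    rw [← h1]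
    congr 1
    ring
  rw [map_smulₛₗ, LinearMap.smul_apply, starRingEnd_apply, star_pow, RamExt.star_y, neg_pow,
    smul_eq_mul, mul_assoc, h1, mul_zero]

end Characters

/-! ### Irreducibility from a `V₀`-fixed generator. -/

section Irreducible

variable {R : Type*} [CommRing R] {x : R}
  {V : Type*} [AddCommGroup V] [Module (RamExt R x) V] {h : SesqForm R x V}
  {lam : AddChar R ℂ} {X : Type*} [AddCommGroup X] [Module ℂ X]

theorem SesqForm.IsNondegHermitian.apply_mul_apply_comm (hh : h.IsNondegHermitian)
    {S : Representation ℂ (Heis h.biadd) X} (hS : ∀ a w, S ⟨a, 0⟩ w = RamExt.mu x lam a • w)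
    (u v : V) : S ⟨0, u⟩ * S ⟨0, v⟩ = h.commChar lam u v • (S ⟨0, v⟩ * S ⟨0, u⟩) := by
  rw [Heis.apply_mul_apply hS, Heis.apply_mul_apply hS, hh.mu_sub, smul_smul, add_comm u v,
    SesqForm.commChar_apply]

variable [IsLocalRing R] [Finite R] (hx : IsLocalRing.maximalIdeal R = Ideal.span {x})

/-- A representation of the Heisenberg group with central character `μ` that is generated by a
vector fixed by `V₀` is irreducible. -/
theorem SesqForm.IsNondegHermitian.isIrreducible_of_fixed
    (hx : IsLocalRing.maximalIdeal R = Ideal.span {x}) [Finite V] [Nontrivial X]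
    [Module.Free (RamExt R x) V] [Module.Finite (RamExt R x) V]
    (hh : h.IsNondegHermitian) (h2 : IsUnit (2 : R)) (hlam : lam.IsPrimitive)
    {S : Representation ℂ (Heis h.biadd) X} (hS : ∀ a w, S ⟨a, 0⟩ w = RamExt.mu x lam a • w)
    (ζ : X) (hfix : ∀ u ∈ V0 R x V, S ⟨0, u⟩ ζ = ζ)
    (hspan : Submodule.span ℂ (Set.range fun v : V => S ⟨0, v⟩ ζ) = ⊤) : S.IsIrreducible := by
  have := Fintype.ofFinite V
  have := Fintype.ofFinite (V0 R x V)
  let P : Module.End ℂ X := ∑ u : V0 R x V, S ⟨0, u⟩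
  have hP : ∀ w, ∃ c : ℂ, P w = c • ζ := by
    intro w
    have hw : w ∈ Submodule.span ℂ (Set.range fun v : V => S ⟨0, v⟩ ζ) :=
      hspan ▸ Submodule.mem_top
    induction hw using Submodule.span_induction with
    | mem w hw =>
      obtain ⟨v, rfl⟩ := hw
      -- Moving `S(0,u)` past `S(0,v)` onto the fixed vector `ζ` leaves a character sum over `V₀`,
      -- which vanishes unless `v ∈ V₀`.
      have h1 : P (S ⟨0, v⟩ ζ) = (∑ u : V0 R x V, h.commChar lam v u) • S ⟨0, v⟩ ζ := by
        rw [LinearMap.sum_apply, ← Equiv.sum_comp (Equiv.neg (V0 R x V)), Finset.sum_smul]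
        refine Finset.sum_congr rfl fun u _ => ?_
        rw [← Module.End.mul_apply, hh.apply_mul_apply_comm hS, LinearMap.smul_apply,
          Module.End.mul_apply, hfix _ (Subtype.coe_prop _), hh.commChar_swap, Equiv.neg_apply,
          Submodule.coe_neg, neg_neg]
      by_cases hv : v ∈ V0 R x V
      · exact ⟨_, by rw [h1, hfix v hv]⟩
      · exact ⟨0, by rw [h1, hh.sum_V0_commChar hx h2 hlam hv, zero_smul, zero_smul]⟩
    | zero => exact ⟨0, by simp⟩
    | add w w' _ _ hw hw' =>
      obtain ⟨c, hc⟩ := hw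
      obtain ⟨c', hc'⟩ := hw'
      exact ⟨c + c', by rw [map_add, hc, hc', add_smul]⟩
    | smul a w _ hw =>
      obtain ⟨c, hc⟩ := hw
      exact ⟨a * c, by rw [map_smul, hc, smul_smul]⟩
  -- Conjugation multiplies each `S(0,u)` by a character of `v`; orthogonality leaves only `u = 0`.
  have hsum : ∑ v : V, S (⟨0, v⟩ : Heis h.biadd)⁻¹ * P * S ⟨0, v⟩ =
      (Fintype.card V : ℂ) • (1 : Module.End ℂ X) := by
    have h1 : ∀ v : V, S (⟨0, v⟩ : Heis h.biadd)⁻¹ * P * S ⟨0, v⟩ =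
        ∑ u : V0 R x V, h.commChar lam u v • S ⟨0, u⟩ := by
      intro v
      rw [Finset.mul_sum, Finset.sum_mul]
      refine Finset.sum_congr rfl fun u _ => ?_
      rw [mul_assoc, hh.apply_mul_apply_comm hS, mul_smul_comm, ← mul_assoc, ← map_mul,
        inv_mul_cancel, map_one, one_mul]
    rw [Finset.sum_congr rfl fun v _ => h1 v, Finset.sum_comm, Finset.sum_eq_single 0]
    · have h3 : S ⟨0, ((0 : V0 R x V) : V)⟩ = 1 := map_one S
      rw [h3, ← Finset.sum_smul]
      congr 1
      simp [SesqForm.commChar_apply]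
    · intro u _ hu
      rw [← Finset.sum_smul, hh.sum_commChar h2 hlam (fun h0 => hu (Subtype.ext h0)), zero_smul]
    · exact fun hn => absurd (Finset.mem_univ _) hn
  have hcard : (Fintype.card V : ℂ) ≠ 0 := Nat.cast_ne_zero.2 Fintype.card_ne_zero
  have htop : ∀ τ : Subrepresentation S, ∀ w ∈ τ.toSubmodule, w ≠ 0 → τ.toSubmodule = ⊤ := by
    intro τ w hw hw0
    -- By `hsum`, `P` cannot kill all translates of `w ≠ 0`, so a nonzero multiple of `ζ` lies in
    -- `τ`.
    have hex : ∃ v : V, P (S ⟨0, v⟩ w) ≠ 0 := by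
      by_contra! h0
      have h1 := LinearMap.congr_fun hsum w
      rw [LinearMap.sum_apply, Finset.sum_eq_zero fun v _ => by
        rw [mul_assoc, Module.End.mul_apply, Module.End.mul_apply, h0, map_zero]] at h1
      exact hw0 ((smul_eq_zero.1 h1.symm).resolve_left hcard)
    obtain ⟨v, hv⟩ := hex
    obtain ⟨c, hc⟩ := hP (S ⟨0, v⟩ w)
    have hc0 : c ≠ 0 := fun h0 => hv (by rw [hc, h0, zero_smul])
    have hmem : P (S ⟨0, v⟩ w) ∈ τ.toSubmodule := by
      rw [LinearMap.sum_apply]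
      exact Submodule.sum_mem _ fun u _ =>
        τ.apply_mem_toSubmodule _ (τ.apply_mem_toSubmodule _ hw)
    rw [hc, Submodule.smul_mem_iff _ hc0] at hmem
    rw [eq_top_iff, ← hspan, Submodule.span_le]
    rintro _ ⟨v, rfl⟩
    exact τ.apply_mem_toSubmodule _ hmem
  exact
    { exists_pair_ne := ⟨⊥, ⊤, fun h0 =>
        bot_ne_top (α := Submodule ℂ X) (congrArg Subrepresentation.toSubmodule h0)⟩
      eq_bot_or_eq_top := fun τ => by
        by_cases hτ : τ.toSubmodule = ⊥
        · exact Or.inl (Subrepresentation.toSubmodule_injective hτ)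
        · obtain ⟨w, hw, hw0⟩ := Submodule.exists_mem_ne_zero_of_ne_bot hτ
          exact Or.inr (Subrepresentation.toSubmodule_injective (htop τ w hw hw0)) }

end Irreducible

/-! ### The Weil module -/

/-! ### The canonical generator of an induced module. -/

section InducedModule

variable {k G H : Type*} [CommRing k] [Group G] [Group H] (φ : G →* H)

theorem Representation.ind_map_mk_one {A : Type*} [AddCommGroup A] [Module k A]
    (ρ : Representation k G A) (g : G) (a : A) :
    Representation.ind φ ρ (φ g) (Representation.IndV.mk φ ρ 1 a) =
      Representation.IndV.mk φ ρ 1 (ρ g a) := by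
  rw [Representation.ind_mk, one_mul]
  have h1 := Representation.Coinvariants.mk_self_apply
    (Representation.tprod ((Representation.leftRegular k H).comp φ) ρ) g
    (TensorProduct.tmul k (MonoidAlgebra.single (φ g)⁻¹ 1) a)
  simpa using h1.symm

theorem Representation.ind_subtype_mk_one {K : Subgroup H} (ρ : Representation k K k) {g : H}
    (hg : g ∈ K) {c : k} (hc : ρ ⟨g, hg⟩ 1 = c) :
    Representation.ind K.subtype ρ g (Representation.IndV.mk K.subtype ρ 1 1) =
      c • Representation.IndV.mk K.subtype ρ 1 1 := by
  have h1 := Representation.ind_map_mk_one K.subtype ρ ⟨g, hg⟩ 1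
  rw [hc] at h1
  rw [← map_smul, smul_eq_mul, mul_one]
  exact h1

/-- The quotient map by the span vanishes on every `IndV.mk g`, because `IndV.mk g` is the translate
by `g⁻¹` of `IndV.mk 1`. -/
theorem Representation.span_ind_mk_one (ρ : Representation k G k) :
    Submodule.span k (Set.range fun g : H =>
      Representation.ind φ ρ g (Representation.IndV.mk φ ρ 1 1)) = ⊤ := by
  set M := Submodule.span k (Set.range fun g : H =>
    Representation.ind φ ρ g (Representation.IndV.mk φ ρ 1 1)) with hM
  have h0 : M.mkQ = 0 := by
    refine Representation.IndV.hom_ext _ _ fun g => LinearMap.ext_ring ?_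
    rw [LinearMap.comp_apply, Submodule.mkQ_apply, LinearMap.zero_comp, LinearMap.zero_apply,
      Submodule.Quotient.mk_eq_zero]
    refine Submodule.subset_span ⟨g⁻¹, ?_⟩
    dsimp only
    rw [Representation.ind_mk, one_mul, inv_inv]
  rw [← M.ker_mkQ, h0, LinearMap.ker_zero]

end InducedModule

section WeilModule

variable {R : Type*} [CommRing R] [IsLocalRing R] [Finite R] {x : R}
  (hx : IsLocalRing.maximalIdeal R = Ideal.span {x})
  {V : Type*} [AddCommGroup V] [Module (RamExt R x) V] {h : SesqForm R x V} {lam : AddChar R ℂ}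

/-- A representation of `U` that is compatible with an irreducible representation of the
Heisenberg group of central character `μ` is multiplicity free. -/
theorem SesqForm.IsNondegHermitian.isMultiplicityFree
    (hx : IsLocalRing.maximalIdeal R = Ideal.span {x}) [Finite V] [Module.Free (RamExt R x) V]
    [Module.Finite (RamExt R x) V] (hh : h.IsNondegHermitian) (h2 : IsUnit (2 : R))
    {X : Type*} [AddCommGroup X] [Module ℂ X] {S : Representation ℂ (Heis h.biadd) X}
    (hirr : S.IsIrreducible) (hS : ∀ a w, S ⟨a, 0⟩ w = RamExt.mu x lam a • w)
    (W : Representation ℂ h.unitary X)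
    (hW : ∀ (g : h.unitary) (k : Heis h.biadd), W g * S k * W g⁻¹ = S (h.act g k)) :
    IsMultiplicityFree W := by
  have : Finite (RamExt R x) := .of_equiv _ (QuadraticAlgebra.equivProd x 0).symm
  have : Finite (Heis h.biadd) :=
    .of_injective (fun k => (k.cen, k.vec)) fun k k' hk => by
      rw [Prod.mk.injEq] at hk
      exact Heis.ext hk.1 hk.2
  have : Finite (V ≃ₗ[RamExt R x] V) := DFunLike.finite _
  have : FiniteDimensional ℂ X := hirr.finiteDimensional_of_finite
  obtain ⟨σ, hσ, horb⟩ := hh.exists_antiIsometry_orbit hx h2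
  exact isMultiplicityFree_of_commute W
    (commute_of_antiIsometry hS hirr.span_range_eq_top W hW σ hσ horb)

/-- A representation of `H ⋊ U` generated by a vector on which `(A, V₀) ⋊ U` acts through `μ` has
a multiplicity free restriction to `U`. -/
theorem SesqForm.IsNondegHermitian.isMultiplicityFree_comp_inr
    (hx : IsLocalRing.maximalIdeal R = Ideal.span {x}) [Finite V]
    [Module.Free (RamExt R x) V] [Module.Finite (RamExt R x) V] (hh : h.IsNondegHermitian)
    (h2 : IsUnit (2 : R)) (hlam : lam.IsPrimitive) {X : Type*} [AddCommGroup X] [Module ℂ X]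
    (ρ : Representation ℂ (Heis h.biadd ⋊[h.act] h.unitary) X) (ζ : X)
    (hρζ : ∀ k ∈ h.inducingSubgroup, ρ k ζ = RamExt.mu x lam k.left.cen • ζ)
    (hspanρ : Submodule.span ℂ (Set.range fun k => ρ k ζ) = ⊤) :
    IsMultiplicityFree (ρ.comp SemidirectProduct.inr) := by
  have : Finite (V ≃ₗ[RamExt R x] V) := DFunLike.finite _
  let S : Representation ℂ (Heis h.biadd) X := ρ.comp SemidirectProduct.inl
  -- Splitting off the zero module makes it unnecessary to prove `ζ ≠ 0`.
  rcases subsingleton_or_nontrivial X with hX | hX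
  · exact isMultiplicityFree_of_commute _ fun _ _ _ _ => Subsingleton.elim _ _
  have hS : ∀ a w, S ⟨a, 0⟩ w = RamExt.mu x lam a • w := by
    intro a w
    have hw : w ∈ Submodule.span ℂ (Set.range fun k => ρ k ζ) := hspanρ ▸ Submodule.mem_top
    induction hw using Submodule.span_induction with
    | mem w hw =>
      obtain ⟨k, rfl⟩ := hw
      -- `(a,0)` is central in `H ⋊ U`, so its scalar action on `ζ` spreads to all translates.
      have hcomm : (SemidirectProduct.inl (⟨a, 0⟩ : Heis h.biadd) :
          Heis h.biadd ⋊[h.act] h.unitary) * k = k * SemidirectProduct.inl ⟨a, 0⟩ := by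
        refine SemidirectProduct.ext (Heis.ext ?_ ?_) ?_
        · change a + k.left.cen + h 0 k.left.vec = k.left.cen + a + h k.left.vec (k.right.1 0)
          rw [map_zero, map_zero, map_zero, LinearMap.zero_apply, add_comm a]
        · change 0 + k.left.vec = k.left.vec + k.right.1 0
          rw [map_zero, zero_add, add_zero]
        · change 1 * k.right = k.right * 1
          rw [one_mul, mul_one]
      change ρ (SemidirectProduct.inl ⟨a, 0⟩) (ρ k ζ) = _
      rw [← Module.End.mul_apply, ← map_mul, hcomm, map_mul, Module.End.mul_apply,
        hρζ _ (V0 R x V).zero_mem, map_smul, SemidirectProduct.left_inl]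
    | zero => rw [map_zero, smul_zero]
    | add w w' _ _ hw hw' => rw [map_add, hw, hw', smul_add]
    | smul c w _ hw => rw [map_smul, hw, smul_comm]
  have hfix : ∀ u ∈ V0 R x V, S ⟨0, u⟩ ζ = ζ := by
    intro u hu
    have h1 := hρζ (SemidirectProduct.inl ⟨0, u⟩) hu
    rwa [SemidirectProduct.left_inl, AddChar.map_zero_eq_one, one_smul] at h1
  have hspan : Submodule.span ℂ (Set.range fun v : V => S ⟨0, v⟩ ζ) = ⊤ := by
    rw [eq_top_iff, ← hspanρ, Submodule.span_le]
    rintro _ ⟨k, rfl⟩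
    -- As `U` fixes `ζ`, the translates of `ζ` under `H` alone already span.
    have h1 : ρ (SemidirectProduct.inr k.right) ζ = ζ := by
      have h1 := hρζ (SemidirectProduct.inr k.right) (V0 R x V).zero_mem
      rwa [SemidirectProduct.left_inr, Heis.one_cen, AddChar.map_zero_eq_one, one_smul] at h1
    have h3 : ρ k ζ = RamExt.mu x lam k.left.cen • S ⟨0, k.left.vec⟩ ζ := by
      conv_lhs => rw [← SemidirectProduct.inl_left_mul_inr_right k, map_mul,
        Module.End.mul_apply, h1]
      exact LinearMap.congr_fun (Heis.apply_eq_smul hS k.left.cen k.left.vec) ζ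
    dsimp only
    rw [h3]
    exact Submodule.smul_mem _ _ (Submodule.subset_span ⟨_, rfl⟩)
  refine hh.isMultiplicityFree hx h2 (hh.isIrreducible_of_fixed hx h2 hlam hS ζ hfix hspan) hS _ ?_
  intro g k
  change ρ _ * ρ _ * ρ _ = ρ _
  rw [SemidirectProduct.inl_aut, map_mul, map_mul]

theorem SesqForm.IsNondegHermitian.isMultiplicityFree_weilModule [Finite V]
    [Module.Free (RamExt R x) V] [Module.Finite (RamExt R x) V] (hh : h.IsNondegHermitian)
    (h2 : IsUnit (2 : R)) (hlam : lam.IsPrimitive) :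
    IsMultiplicityFree (h.weilModule hx lam) := by
  have hχ : ∀ (k : Heis h.biadd ⋊[h.act] h.unitary) (hk : k ∈ h.inducingSubgroup),
      h.inducingRep hx lam ⟨k, hk⟩ 1 = RamExt.mu x lam k.left.cen := fun k _ =>
    mul_one (RamExt.mu x lam k.left.cen)
  exact hh.isMultiplicityFree_comp_inr hx h2 hlam _ _
    (fun k hk => Representation.ind_subtype_mk_one _ hk (hχ k hk))
    (Representation.span_ind_mk_one _ _)

end WeilModule

theorem mainTheorem1 {R : Type*} [CommRing R] [Finite R] [IsLocalRing R] [IsPrincipalIdealRing R]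
    (hodd : Odd (ringChar R))
    (x : R) (hx : IsLocalRing.maximalIdeal R = Ideal.span {x})
    {V : Type*} [AddCommGroup V] [Module (RamExt R x) V] [Module.Free (RamExt R x) V]
    [Module.Finite (RamExt R x) V] [Nontrivial V]
    (h : SesqForm R x V) (hh : h.IsNondegHermitian)
    (lam : AddChar R ℂ) (hlam : lam.IsPrimitive) :
    IsMultiplicityFree (h.weilModule hx lam) ∧
    ∀ {X : Type*} [AddCommGroup X] [Module ℂ X] (W : Representation ℂ h.unitary X),
      h.IsWeil (RamExt.mu x lam) W → IsMultiplicityFree W := by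
  have h2 := isUnit_two_of_odd_ringChar hodd
  have : Finite (RamExt R x) := .of_equiv _ (QuadraticAlgebra.equivProd x 0).symm
  have : Finite V := Module.finite_of_finite (RamExt R x)
  refine ⟨hh.isMultiplicityFree_weilModule hx h2 hlam, fun W => ?_⟩
  rintro ⟨S, hS, hW⟩
  exact hh.isMultiplicityFree hx h2 hS.irreducible hS.central W hW
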